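/- A deterministic linear context-free language is a language accepted, by final state, by a deterministic pushdown automaton (with $\varepsilon$-moves allowed) that makes at most one reversal on its stack, that is, in every computation from an initial configuration no move that increases the height of the stack occurs after a move that decreases it. For words $u,v$ over a finite alphabet $\Sigma$, the shuffle $u \mathbin{\sqcup\!\sqcup} v$ is the set of all words $u_1v_1u_2v_2\cdots u_nv_n$ with $u=u_1\cdots u_n$ and $v=v_1\cdots v_n$, where $u_i,v_i\in\Sigma^*$ may be empty. **Theorem.** It is undecidable for deterministic linear context-free languages $L$ whether $L$ contains an element of $w \mathbin{\sqcup\!\sqcup} w$ for some word $w$. That is, there is no algorithm which, given a deterministic pushdown automaton that makes at most one reversal on its stack, with accepted language $L\subseteq\Sigma^*$, decides whether $L\cap(w \mathbin{\sqcup\!\sqcup} w)\neq\emptyset$ for some $w\in\Sigma^*$. -/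

import Mathlib

/-! Words are lists, languages are `Language α`.  A pushdown automaton is given by a finite
description, in which states, input letters and stack symbols are numbered from `0`. -/

/-- The shuffle of `u` and `v`: all words `u₁v₁ ⋯ uₙvₙ` where `u = u₁ ⋯ uₙ` and `v = v₁ ⋯ vₙ`
are factorizations into possibly empty factors. The list `l` is `(u₁, v₁), …, (uₙ, vₙ)`. -/
def wordShuffle {α : Type*} (u v : List α) : Language α :=
  {x | ∃ l : List (List α × List α),
    u = (l.map fun p => p.1).flatten ∧ v = (l.map fun p => p.2).flatten ∧
    x = (l.map fun p => p.1 ++ p.2).flatten}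

/-- `L` contains an element of the shuffle of `w` with itself, for some word `w`. -/
def ContainsSelfShuffle {α : Type*} (L : Language α) : Prop :=
  ∃ w : List α, ∃ x ∈ wordShuffle w w, x ∈ L

/-- A move of a pushdown automaton: in state `source` with `top` as the topmost stack symbol, read
the letter `a` (if `read = some a`) or nothing (if `read = none`), replace `top` by the word `push`
(whose first symbol becomes the new topmost symbol) and go to state `target`. -/
structure PDAMove where
  source : ℕ
  read : Option ℕ
  top : ℕ
  target : ℕ
  push : List ℕ

/-- A finite description of a (nondeterministic) pushdown automaton with states
`0, …, numStates - 1`, input alphabet `0, …, numLetters - 1` and stack alphabet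
`0, …, numSymbols - 1`. That the data lie in these ranges is `PDA.WellFormed`. -/
structure PDA where
  numStates : ℕ
  numLetters : ℕ
  numSymbols : ℕ
  start : ℕ
  bottom : ℕ
  accept : List ℕ
  moves : List PDAMove

/-- Moves as tuples of their entries. -/
def PDAMove.equivTuple : PDAMove ≃ ℕ × Option ℕ × ℕ × ℕ × List ℕ where
  toFun t := (t.source, t.read, t.top, t.target, t.push)
  invFun t := ⟨t.1, t.2.1, t.2.2.1, t.2.2.2.1, t.2.2.2.2⟩
  left_inv _ := rfl
  right_inv _ := rfl

instance PDAMove.instPrimcodable : Primcodable PDAMove :=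
  Primcodable.ofEquiv _ PDAMove.equivTuple

/-- Descriptions as tuples of their entries. -/
def PDA.equivTuple : PDA ≃ ℕ × ℕ × ℕ × ℕ × ℕ × List ℕ × List PDAMove where
  toFun M :=
    (M.numStates, M.numLetters, M.numSymbols, M.start, M.bottom, M.accept, M.moves)
  invFun t := ⟨t.1, t.2.1, t.2.2.1, t.2.2.2.1, t.2.2.2.2.1, t.2.2.2.2.2.1, t.2.2.2.2.2.2⟩
  left_inv _ := rfl
  right_inv _ := rfl

/-- Descriptions of pushdown automata are inputs of algorithms through the tuple encoding. -/
instance PDA.instPrimcodable : Primcodable PDA :=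
  Primcodable.ofEquiv _ PDA.equivTuple

/-- A configuration: the state, the input still to be read, and the stack, topmost symbol first. -/
structure PDAConfig where
  state : ℕ
  input : List ℕ
  stack : List ℕ

namespace PDA

/-- All states, letters and stack symbols that occur lie in the declared finite sets. In
particular every word of the language is a word over the input alphabet. -/
def WellFormed (M : PDA) : Prop :=
  M.start < M.numStates ∧ M.bottom < M.numSymbols ∧ (∀ q ∈ M.accept, q < M.numStates) ∧
  ∀ t ∈ M.moves, t.source < M.numStates ∧ t.target < M.numStates ∧ t.top < M.numSymbols ∧
    (∀ a ∈ t.read, a < M.numLetters) ∧ ∀ X ∈ t.push, X < M.numSymbols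

/-- One move of the automaton; `t.read.toList` is the one-letter word or the empty word that the
move reads. -/
inductive Step (M : PDA) : PDAConfig → PDAConfig → Prop
  | move (t : PDAMove) (ht : t ∈ M.moves) (w s : List ℕ) :
      Step M ⟨t.source, t.read.toList ++ w, t.top :: s⟩ ⟨t.target, w, t.push ++ s⟩

/-- Finitely many moves, possibly none. -/
def Reaches (M : PDA) : PDAConfig → PDAConfig → Prop :=
  Relation.ReflTransGen M.Step

/-- The initial configuration on input `w`. -/
def initial (M : PDA) (w : List ℕ) : PDAConfig :=
  ⟨M.start, w, [M.bottom]⟩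

/-- The accepted language: some computation reads the whole input and ends in an accepting
state. -/
def language (M : PDA) : Language ℕ :=
  {w | ∃ q ∈ M.accept, ∃ s : List ℕ, M.Reaches (M.initial w) ⟨q, [], s⟩}

/-- For a given state and topmost stack symbol there is at most one move for every letter and at
most one move that reads nothing, and the latter excludes the former. -/
def Deterministic (M : PDA) : Prop :=
  ∀ t₁ ∈ M.moves, ∀ t₂ ∈ M.moves, t₁.source = t₂.source → t₁.top = t₂.top →
    (t₁.read = t₂.read ∨ t₁.read = none ∨ t₂.read = none) → t₁ = t₂

/-- The automaton makes at most one reversal on its stack: in every computation from an initial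
configuration, after a move that decreases the height of the stack no move increases it. -/
def OneReversal (M : PDA) : Prop :=
  ∀ (w : List ℕ) (c₁ c₂ c₃ c₄ : PDAConfig),
    M.Reaches (M.initial w) c₁ → M.Step c₁ c₂ → c₂.stack.length < c₁.stack.length →
    M.Reaches c₂ c₃ → M.Step c₃ c₄ → c₄.stack.length ≤ c₃.stack.length

/-- `M` is a deterministic linear pushdown automaton. The languages of these automata are the
deterministic linear context-free languages. -/
def DeterministicLinear (M : PDA) : Prop :=
  M.WellFormed ∧ M.Deterministic ∧ M.OneReversal

end PDA

/-- An algorithm decides `P` on the instances that satisfy `D`: a partial computable function halts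
with the correct answer on every such instance (nothing is asked of it on other inputs). -/
def AlgorithmicallyDecidableOn {α : Type*} [Primcodable α] (D P : α → Prop) : Prop :=
  ∃ f : α →. Bool, Partrec f ∧ ∀ a, D a → ∃ b ∈ f a, (b = true ↔ P a)

/-! The halting problem is reduced to the question about self-shuffles.

Let `T` be a finite set of tiles and `s` a word. The automaton accepts words `0 I 1 v 2 0 J 1 v' 2`
where `I` and `J` are sequences of tile names. It pushes `s`, the second components of `I`, a
separator and `v`, and then pops, so acceptance forces the reversal of `v` to be the concatenation
of the first components of `J`, and the reversal of `v'` to be `s` followed by the second components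
of `I`. The two conditions share no data. A self-shuffle links them: the markers `0` and `2` delimit
each half, and a shuffle of a word with itself of this shape must have equal halves
(`eq_of_mem_wordShuffle_self`). Then `I = J` and `v = v'`, which is a match; conversely a match
gives an accepted square `w ++ w` (`MatchPDA.containsSelfShuffle_automaton_iff`).

Matching is undecidable by the classical route: tiles simulate string rewriting
(`hasMatch_rewritingTile_iff`), and rewriting simulates a Turing machine
(`exists_derives_halted_iff`). One universal machine is fixed, with a tape input that is a constant
prefix followed by `n` copies of a letter (`Partrec.exists_TM0`). Hence the tiles are constant and
only `s` depends on the instance. As `s` enters only the first move of the automaton, the reduction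
is computable although the fixed data are chosen nonconstructively. -/

/-! ### String rewriting and matching of tiles -/

/-- One application of a rule of `R` inside a word. -/
def Rewrites {α : Type*} (R : Set (List α × List α)) (u v : List α) : Prop :=
  ∃ p s : List α, ∃ t ∈ R, u = p ++ t.1 ++ s ∧ v = p ++ t.2 ++ s

/-- Finitely many applications of rules of `R`. -/
abbrev Derives {α : Type*} (R : Set (List α × List α)) : List α → List α → Prop :=
  Relation.ReflTransGen (Rewrites R)

/-- Some sequence of tiles from `T` has a concatenation of first components equal to `s` followed
by its concatenation of second components. -/
def HasMatch {α : Type*} (T : Set (List α × List α)) (s : List α) : Prop :=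
  ∃ I : List (List α × List α), (∀ t ∈ I, t ∈ T) ∧
    I.flatMap Prod.fst = s ++ I.flatMap Prod.snd

/-- The tiles that simulate a rewriting system, where `sep` separates consecutive words and `fin`
marks the end of a derivation. -/
inductive RewritingTile {α : Type*} (R : Set (List α × List α)) (sep fin : α) :
    List α × List α → Prop
  | copy (a : α) (ha : a ≠ sep) : RewritingTile R sep fin ([a], [a])
  | next : RewritingTile R sep fin ([sep], [sep])
  | rule (t : List α × List α) (ht : t ∈ R) : RewritingTile R sep fin t
  | absorbLeft (a : α) (ha : a ≠ sep) : RewritingTile R sep fin ([a, fin], [fin])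
  | absorbRight (a : α) (ha : a ≠ sep) : RewritingTile R sep fin ([fin, a], [fin])
  | finish : RewritingTile R sep fin ([fin, sep], [])

theorem List.exists_eq_append_of_append_eq_append_cons {α : Type*} {l x c y : List α} {a : α}
    (h : l ++ x = c ++ a :: y) (ha : a ∉ l) : ∃ d, c = l ++ d ∧ x = d ++ a :: y := by
  rcases List.append_eq_append_iff.1 h with ⟨d, hc, hx⟩ | ⟨d, hl, hy⟩
  · exact ⟨d, hc, hx⟩
  · cases d with
    | nil => exact ⟨[], by simp_all, by simp_all⟩
    | cons b d =>
      simp only [List.cons_append, List.cons.injEq] at hy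
      exact absurd (by simp [hl, hy.1]) ha

/-- In the right-hand word the letter `a` can stand only at the distinguished position. Avoidance is
thus needed on one side only. -/
theorem List.append_cons_inj_of_not_mem_right {α : Type*} {x y x' y' : List α} {a a' : α}
    (h : x ++ a :: y = x' ++ a' :: y') (hx : a ∉ x') (hy : a ∉ y') : x = x' ∧ a = a' ∧ y = y' := by
  rcases List.append_eq_append_iff.1 h with ⟨d, h₁, h₂⟩ | ⟨d, h₁, h₂⟩
  · cases d with
    | nil => simp_all
    | cons b d => simp_all
  · cases d with
    | nil => simp_all
    | cons b d => simp_all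

section Rewriting

variable {α : Type*} {R : Set (List α × List α)} {sep fin : α}

/-- Invariant while the tiles are laid: `c` is the part of the current word not yet matched, `d` the
part of the next word already produced, and `d ++ c` is derivable, since rewriting a prefix is
itself a derivation. A tile moves its first component off `c` and its second onto `d`; at `sep` the
next word becomes the current one. The first absorbing or finishing tile exhibits `fin` in `c`. -/
theorem exists_derivation_of_match (hne : fin ≠ sep) (hR₁ : ∀ t ∈ R, sep ∉ t.1)
    (hR₂ : ∀ t ∈ R, sep ∉ t.2) {s : List α} (I : List (List α × List α)) :
    ∀ c d : List α, (∀ t ∈ I, RewritingTile R sep fin t) →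
      I.flatMap Prod.fst = c ++ sep :: (d ++ I.flatMap Prod.snd) → sep ∉ c → sep ∉ d →
      Derives R s (d ++ c) →
      ∃ v, Derives R s v ∧ fin ∈ v := by
  induction I with
  | nil => intro c d _ h; simp at h
  | cons t I ih =>
    intro c d hI h hc hd hs
    have hI' : ∀ t ∈ I, RewritingTile R sep fin t := fun t ht => hI t (by simp [ht])
    rw [List.flatMap_cons] at h
    cases hI t (by simp) with
    | copy a ha =>
      obtain ⟨c', rfl, hx⟩ := List.exists_eq_append_of_append_eq_append_cons h
        (by simpa using ha.symm)
      refine ih c' (d ++ [a]) hI' (by simpa using hx) (by simp_all) (by simp_all [eq_comm]) ?_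
      simpa using hs
    | next =>
      cases c with
      | nil =>
        simp only [List.nil_append, List.cons_append, List.cons.injEq, true_and] at h
        exact ih d [] hI' (by simpa using h) hd (by simp) (by simpa using hs)
      | cons b c => simp_all
    | rule t ht =>
      obtain ⟨c', rfl, hx⟩ := List.exists_eq_append_of_append_eq_append_cons h (hR₁ t ht)
      refine ih c' (d ++ t.2) hI' (by simpa using hx) (by simp_all)
        (by have := hR₂ t ht; simp_all) ?_
      exact hs.tail ⟨d, c', t, ht, by simp, by simp⟩
    | absorbLeft a ha =>
      obtain ⟨c', rfl, hx⟩ := List.exists_eq_append_of_append_eq_append_cons h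
        (by simp [ha.symm, hne.symm])
      exact ⟨_, hs, by simp⟩
    | absorbRight a ha =>
      obtain ⟨c', rfl, hx⟩ := List.exists_eq_append_of_append_eq_append_cons h
        (by simp [ha.symm, hne.symm])
      exact ⟨_, hs, by simp⟩
    | finish =>
      refine ⟨_, hs, ?_⟩
      cases c with
      | nil => simp_all
      | cons b c => simp_all

theorem flatMap_fst_map_diag (w : List α) :
    (w.map fun a => ([a], [a])).flatMap Prod.fst = w := by
  induction w <;> simp_all

theorem flatMap_snd_map_diag (w : List α) :
    (w.map fun a => ([a], [a])).flatMap Prod.snd = w := by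
  induction w <;> simp_all

/-- One full pass over `u`: copy `p`, lay `t`, copy `s`, lay `sep`. What is then left to match is `v
++ [sep]`. -/
theorem HasMatch.of_tile {u v p s : List α} {t : List α × List α}
    (h : HasMatch {t | RewritingTile R sep fin t} (v ++ [sep])) (ht : RewritingTile R sep fin t)
    (hu : u = p ++ t.1 ++ s) (hv : v = p ++ t.2 ++ s) (hsep : sep ∉ u) :
    HasMatch {t | RewritingTile R sep fin t} (u ++ [sep]) := by
  subst hu hv
  obtain ⟨I, hI, h⟩ := h
  refine ⟨(p.map fun a => ([a], [a])) ++ t :: (s.map fun a => ([a], [a])) ++ ([sep], [sep]) :: I,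
    ?_, ?_⟩
  · intro t' ht'
    simp only [List.mem_append, List.mem_cons, List.mem_map] at ht'
    rcases ht' with (⟨a, ha, rfl⟩ | rfl | ⟨a, ha, rfl⟩) | rfl | ht'
    · exact .copy a (by rintro rfl; simp_all)
    · exact ht
    · exact .copy a (by rintro rfl; simp_all)
    · exact .next
    · exact hI _ ht'
  · simp only [List.flatMap_append, List.flatMap_cons, flatMap_fst_map_diag, flatMap_snd_map_diag,
      h]
    simp

/-- The letter `fin` swallows one neighbour per pass until it stands alone; the finishing tile, with
empty second component, then closes the match. -/
theorem hasMatch_of_fin_mem (hne : fin ≠ sep) (p s : List α) (hp : sep ∉ p) (hs : sep ∉ s) :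
    HasMatch {t | RewritingTile R sep fin t} (p ++ fin :: s ++ [sep]) := by
  have absorb : HasMatch {t | RewritingTile R sep fin t} (fin :: s ++ [sep]) := by
    induction s with
    | nil => exact ⟨[([fin, sep], [])], by simpa using .finish, by simp⟩
    | cons a s ih =>
      simp only [List.mem_cons, not_or] at hs
      refine (ih hs.2).of_tile (p := []) (s := s) (.absorbRight a (Ne.symm hs.1)) (by simp)
        (by simp) ?_
      simp [hs, hne.symm]
  induction p using List.reverseRecOn with
  | nil => simpa using absorb
  | append_singleton p b ih =>
    simp only [List.mem_append, List.mem_singleton, not_or] at hp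
    refine (ih hp.1).of_tile (p := p) (s := s) (.absorbLeft b (Ne.symm hp.2)) (by simp) (by simp) ?_
    simp [hs, hne.symm, hp]

theorem hasMatch_rewritingTile_iff (hne : fin ≠ sep) (hR₁ : ∀ t ∈ R, sep ∉ t.1)
    (hR₂ : ∀ t ∈ R, sep ∉ t.2) {s : List α} (hs : sep ∉ s) :
    HasMatch {t | RewritingTile R sep fin t} (s ++ [sep]) ↔
      ∃ v, Derives R s v ∧ fin ∈ v := by
  constructor
  · rintro ⟨I, hI, h⟩
    exact exists_derivation_of_match hne hR₁ hR₂ I s [] hI (by simpa using h) hs (by simp)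
      (by simpa using .refl)
  · rintro ⟨v, hv, hfin⟩
    induction hv using Relation.ReflTransGen.head_induction_on with
    | refl =>
      obtain ⟨p, q, rfl⟩ := List.append_of_mem hfin
      exact hasMatch_of_fin_mem hne p q (by simp_all) (by simp_all)
    | head h _ ih =>
      obtain ⟨p, q, t, ht, rfl, rfl⟩ := h
      have := hR₂ t ht
      exact (ih (by simp_all)).of_tile (.rule t ht) rfl rfl hs

theorem finite_rewritingTile [Finite α] (hR : R.Finite) :
    {t | RewritingTile R sep fin t}.Finite := by
  -- Apart from the rules, every tile has components of length at most 2.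
  refine (hR.union (((List.finite_length_le α 2).prod (List.finite_length_le α 2)))).subset ?_
  rintro _ (⟨a, -⟩ | _ | ⟨t, ht⟩ | ⟨a, -⟩ | ⟨a, -⟩ | _)
  case rule => exact .inl ht
  all_goals exact .inr (by simp)

end Rewriting

theorem HasMatch.image {α β : Type*} {T : Set (List α × List α)} {s : List α} (f : α → β)
    (h : HasMatch T s) : HasMatch (Prod.map (List.map f) (List.map f) '' T) (s.map f) := by
  obtain ⟨I, hI, h⟩ := h
  refine ⟨I.map (Prod.map (List.map f) (List.map f)), ?_, ?_⟩
  · intro t ht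
    obtain ⟨u, hu, rfl⟩ := List.mem_map.1 ht
    exact ⟨u, hI u hu, rfl⟩
  · have := congrArg (List.map f) h
    simpa [List.flatMap_map, List.map_flatMap] using this

theorem hasMatch_image_iff {α β : Type*} {T : Set (List α × List α)} {s : List α} {f : α → β}
    (hf : Function.Injective f) :
    HasMatch (Prod.map (List.map f) (List.map f) '' T) (s.map f) ↔ HasMatch T s := by
  refine ⟨?_, .image f⟩
  rintro ⟨I, hI, h⟩
  obtain ⟨J, hJ, rfl⟩ : ∃ J : List (List α × List α), (∀ t ∈ J, t ∈ T) ∧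
      J.map (Prod.map (List.map f) (List.map f)) = I := by
    clear h
    induction I with
    | nil => exact ⟨[], by simp⟩
    | cons t I ih =>
      obtain ⟨J, hJ, rfl⟩ := ih fun t ht => hI t (by simp [ht])
      obtain ⟨t, ht, rfl⟩ := hI t (by simp)
      exact ⟨t :: J, by simpa [ht] using hJ, rfl⟩
  refine ⟨J, hJ, hf.list_map ?_⟩
  simpa [List.flatMap_map, List.map_flatMap] using h

/-! ### Shuffles of a word with itself -/

/-- Interleavings of two words, letter by letter. -/
inductive Interleaving {α : Type*} : List α → List α → List α → Prop
  | nil : Interleaving [] [] []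
  | left (a : α) {u v x : List α} : Interleaving u v x → Interleaving (a :: u) v (a :: x)
  | right (a : α) {u v x : List α} : Interleaving u v x → Interleaving u (a :: v) (a :: x)

namespace Interleaving

variable {α : Type*} {u v x : List α}

theorem append_left (w : List α) (h : Interleaving u v x) : Interleaving (w ++ u) v (w ++ x) := by
  induction w with
  | nil => exact h
  | cons a w ih => exact ih.left a

theorem append_right (w : List α) (h : Interleaving u v x) : Interleaving u (w ++ v) (w ++ x) := by
  induction w with
  | nil => exact h
  | cons a w ih => exact ih.right a

theorem symm (h : Interleaving u v x) : Interleaving v u x := by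
  induction h with
  | nil => exact .nil
  | left a _ ih => exact ih.right a
  | right a _ ih => exact ih.left a

theorem eq_of_nil_left (h : Interleaving [] v x) : v = x := by
  generalize hu : ([] : List α) = u at h
  induction h with
  | nil => rfl
  | left => cases hu
  | right a _ ih => rw [ih hu]

theorem count_eq [DecidableEq α] (h : Interleaving u v x) (a : α) :
    x.count a = u.count a + v.count a := by
  induction h with
  | nil => rfl
  | left b _ ih => simp only [List.count_cons, ih]; omega
  | right b _ ih => simp only [List.count_cons, ih]; omega

theorem getLast?_eq (h : Interleaving u v x) :
    x.getLast? = u.getLast? ∨ x.getLast? = v.getLast? := by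
  induction h with
  | nil => simp
  | @left a u v x h ih =>
    cases x with
    | nil => cases h; simp
    | cons b x =>
      rcases ih with ih | ih
      · left
        cases u <;> simp_all
      · right
        simpa using ih
  | @right a u v x h ih =>
    cases x with
    | nil => cases h; simp
    | cons b x =>
      rcases ih with ih | ih
      · left
        simpa using ih
      · right
        cases v <;> simp_all

/-- A letter `a` that occurs only at the head of the second word forces what precedes it to come
from the first word. -/
theorem split_at_head {a : α} {p r : List α} (h : Interleaving u (a :: v) (p ++ a :: r))
    (hu : a ∉ u) (hp : a ∉ p) : ∃ u', u = p ++ u' ∧ Interleaving u' v r := by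
  induction p generalizing u with
  | nil =>
    cases h with
    | left => simp at hu
    | right _ h => exact ⟨u, rfl, h⟩
  | cons b p ih =>
    simp only [List.mem_cons, not_or] at hp
    cases h with
    | left _ h =>
      obtain ⟨u', rfl, h'⟩ := ih h (by simp_all) hp.2
      exact ⟨u', rfl, h'⟩
    | right => simp at hp

end Interleaving

theorem interleaving_of_mem_wordShuffle {α : Type*} {u v x : List α} (h : x ∈ wordShuffle u v) :
    Interleaving u v x := by
  obtain ⟨l, rfl, rfl, rfl⟩ := h
  induction l with
  | nil => exact .nil
  | cons t l ih =>
    simpa using (ih.append_right t.2).append_left t.1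

theorem append_self_mem_wordShuffle {α : Type*} (w : List α) : w ++ w ∈ wordShuffle w w :=
  ⟨[(w, w)], by simp, by simp, by simp⟩

/-- If a shuffle of a word with itself consists of two blocks, each delimited by a letter `a` on the
left and a letter `b` on the right that occur nowhere else, then the blocks are equal. -/
theorem eq_of_mem_wordShuffle_self {α : Type*} {a b : α} {w p q : List α} (hab : a ≠ b)
    (hap : a ∉ p) (haq : a ∉ q) (hbp : b ∉ p) (hbq : b ∉ q)
    (hw : a :: (p ++ b :: a :: (q ++ [b])) ∈ wordShuffle w w) : p = q := by
  classical
  -- By symmetry the first letter may be taken from the first copy of `w`.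
  obtain ⟨u, rfl, h⟩ : ∃ u, w = a :: u ∧
      Interleaving u (a :: u) ((p ++ [b]) ++ a :: (q ++ [b])) := by
    have h := interleaving_of_mem_wordShuffle hw
    cases w with
    | nil => cases h
    | cons c u =>
      obtain rfl : c = a := by cases h <;> rfl
      refine ⟨u, rfl, ?_⟩
      cases h with
      | left _ h => simpa using h
      | right _ h => simpa using h.symm
  -- One `a` remains in the shuffle, and the head of the second copy accounts for it.
  have hau : a ∉ u := by
    have := h.count_eq a
    simp [List.count_eq_zero_of_not_mem, hap, haq, hab.symm] at this
    exact List.count_eq_zero.1 (by omega)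
  -- The second copy starts at the second `a`, so the first block comes entirely from the first
  -- copy; `u'` is what that copy has left.
  obtain ⟨u', rfl, h'⟩ := h.split_at_head hau (by simp [hap, hab])
  have hb : b ∉ u' := by
    have := h'.count_eq b
    simp [List.count_eq_zero_of_not_mem, hbp, hbq] at this
    exact List.count_eq_zero.1 (by omega)
  -- If `u'` were nonempty, both remaining words would end in its last letter, which would have to
  -- be `b`.
  have hlast := h'.getLast?_eq
  obtain rfl : u' = [] := by
    rcases List.eq_nil_or_concat u' with hu | ⟨u₀, c, rfl⟩
    · exact hu
    · simp only [List.concat_eq_append, ← List.append_assoc, List.getLast?_append,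
        List.getLast?_singleton, Option.some_or, or_self, Option.some.injEq] at hlast
      simp [hlast] at hb
  simpa using h'.eq_of_nil_left

/-! ### A deterministic one-reversal automaton that checks a match -/

namespace MatchPDA

/-- The input letter for a tile. -/
def tileLetter (t : List ℕ × List ℕ) : ℕ := 2 * Encodable.encode t + 3

/-- The input letter for a letter of the matched word. -/
def wordLetter (b : ℕ) : ℕ := 2 * b + 4

/-- The state in which the word `r` has still to be popped. -/
def popState (r : List ℕ) : ℕ := Encodable.encode r + 6

/-- The stack symbol for a letter of the matched word. -/
def symbol (b : ℕ) : ℕ := b + 2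

/-- The moves of the automaton for the tiles `T` over the letters below `K`, except for its first
move. On input `0 I 1 v 2 0 I' 1 v' 2` the first half is used for pushing the second components of
`I`, a separator and `v`, the second half for popping `v` by the first components of `I'`
and the rest by `v'`. -/
inductive IsMove (T : List (List ℕ × List ℕ)) (K : ℕ) : PDAMove → Prop
  | pushTile (t : List ℕ × List ℕ) (ht : t ∈ T) (X : ℕ) (hX : X < K + 2) :
      IsMove T K ⟨1, some (tileLetter t), X, 1, t.2.reverse.map symbol ++ [X]⟩
  | pushSeparator (X : ℕ) (hX : X < K + 2) : IsMove T K ⟨1, some 1, X, 2, [1, X]⟩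
  | pushLetter (b : ℕ) (hb : b < K) (X : ℕ) (hX : X < K + 2) :
      IsMove T K ⟨2, some (wordLetter b), X, 2, [symbol b, X]⟩
  | endFirst (X : ℕ) (hX : X < K + 2) : IsMove T K ⟨2, some 2, X, 3, [X]⟩
  | beginSecond (X : ℕ) (hX : X < K + 2) : IsMove T K ⟨3, some 0, X, popState [], [X]⟩
  | readTile (t : List ℕ × List ℕ) (ht : t ∈ T) (X : ℕ) (hX : X < K + 2) :
      IsMove T K ⟨popState [], some (tileLetter t), X, popState t.1, [X]⟩
  | popTile (t : List ℕ × List ℕ) (ht : t ∈ T) (b : ℕ) (r : List ℕ) (hr : b :: r <:+ t.1) :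
      IsMove T K ⟨popState (b :: r), none, symbol b, popState r, []⟩
  | popSeparator : IsMove T K ⟨popState [], some 1, 1, 4, []⟩
  | popLetter (b : ℕ) (hb : b < K) : IsMove T K ⟨4, some (wordLetter b), symbol b, 4, []⟩
  | endSecond : IsMove T K ⟨4, some 2, 0, 5, [0]⟩

theorem finite_isMove (T : List (List ℕ × List ℕ)) (K : ℕ) : {m | IsMove T K m}.Finite := by
  have hT : {t | t ∈ T}.Finite := T.finite_toSet
  have hK : (Set.Iio (K + 2)).Finite := Set.finite_Iio _
  have hK' : (Set.Iio K).Finite := Set.finite_Iio _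
  have hS : {p : List ℕ × List ℕ | p.2 <:+ p.1 ∧ ∃ t ∈ T, t.1 = p.1}.Finite := by
    refine (T.flatMap fun t => t.1.tails.map fun r => (t.1, r)).finite_toSet.subset ?_
    rintro ⟨l, r⟩ ⟨hr, t, ht, rfl⟩
    simp only [List.mem_flatMap, List.mem_map, List.mem_tails, Set.mem_ofPred_eq]
    exact ⟨t, ht, r, hr, rfl⟩
  refine (((hT.prod hK).image fun p => (⟨1, some (tileLetter p.1), p.2, 1,
      p.1.2.reverse.map symbol ++ [p.2]⟩ : PDAMove)).union <|
    (hK.image fun X => (⟨1, some 1, X, 2, [1, X]⟩ : PDAMove)).union <|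
    ((hK'.prod hK).image fun p =>
      (⟨2, some (wordLetter p.1), p.2, 2, [symbol p.1, p.2]⟩ : PDAMove)).union <|
    (hK.image fun X => (⟨2, some 2, X, 3, [X]⟩ : PDAMove)).union <|
    (hK.image fun X => (⟨3, some 0, X, popState [], [X]⟩ : PDAMove)).union <|
    ((hT.prod hK).image fun p =>
      (⟨popState [], some (tileLetter p.1), p.2, popState p.1.1, [p.2]⟩ : PDAMove)).union <|
    -- Here `p.2` is `b :: r`. The empty suffix contributes spurious moves, harmless because only an
    -- inclusion is needed.
    (hS.image fun p =>
      (⟨popState p.2, none, symbol p.2.headI, popState p.2.tail, []⟩ : PDAMove)).union <|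
    (hK'.image fun b => (⟨4, some (wordLetter b), symbol b, 4, []⟩ : PDAMove)).union <|
    Set.toFinite {⟨popState [], some 1, 1, 4, []⟩, ⟨4, some 2, 0, 5, [0]⟩}).subset ?_
  rintro _ (⟨t, ht, X, hX⟩ | ⟨X, hX⟩ | ⟨b, hb, X, hX⟩ | ⟨X, hX⟩ | ⟨X, hX⟩ | ⟨t, ht, X, hX⟩ |
    ⟨t, ht, b, r, hr⟩ | _ | ⟨b, hb⟩ | _)
  · exact .inl ⟨(t, X), ⟨ht, hX⟩, rfl⟩
  · exact .inr <| .inl ⟨X, hX, rfl⟩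
  · exact .inr <| .inr <| .inl ⟨(b, X), ⟨hb, hX⟩, rfl⟩
  · exact .inr <| .inr <| .inr <| .inl ⟨X, hX, rfl⟩
  · exact .inr <| .inr <| .inr <| .inr <| .inl ⟨X, hX, rfl⟩
  · exact .inr <| .inr <| .inr <| .inr <| .inr <| .inl ⟨(t, X), ⟨ht, hX⟩, rfl⟩
  · exact .inr <| .inr <| .inr <| .inr <| .inr <| .inr <|
      .inl ⟨(t.1, b :: r), ⟨hr, t, ht, rfl⟩, rfl⟩
  · exact .inr <| .inr <| .inr <| .inr <| .inr <| .inr <| .inr <| .inr (by simp)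
  · exact .inr <| .inr <| .inr <| .inr <| .inr <| .inr <| .inr <| .inl ⟨b, hb, rfl⟩
  · exact .inr <| .inr <| .inr <| .inr <| .inr <| .inr <| .inr <| .inr (by simp)

/-- The moves of the automaton that do not depend on the initial word, as a list. -/
noncomputable def fixedMoves (T : List (List ℕ × List ℕ)) (K : ℕ) : List PDAMove :=
  (finite_isMove T K).toFinset.toList

theorem mem_fixedMoves {T : List (List ℕ × List ℕ)} {K : ℕ} {m : PDAMove} :
    m ∈ fixedMoves T K ↔ IsMove T K m := by
  simp [fixedMoves]

/-- The first move, which pushes the initial word `s`. -/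
def firstMove (s : List ℕ) : PDAMove :=
  ⟨0, some 0, 0, 1, s.reverse.map symbol ++ [0]⟩

/-- A number that exceeds all entries of a move. -/
def moveBound (m : PDAMove) : ℕ :=
  m.source + m.target + m.top + m.read.getD 0 + m.push.sum + 1

/-- A number that exceeds all entries of the fixed moves. -/
noncomputable def bound (T : List (List ℕ × List ℕ)) (K : ℕ) : ℕ :=
  ((fixedMoves T K).map moveBound).sum + K + 6

/-- The automaton that checks a match of the tiles `T` with initial word `s`. -/
noncomputable def automaton (T : List (List ℕ × List ℕ)) (K : ℕ) (s : List ℕ) : PDA :=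
  ⟨bound T K, bound T K, bound T K, 0, 0, [5], firstMove s :: fixedMoves T K⟩

/-! ### The automaton is deterministic linear. -/

variable {T : List (List ℕ × List ℕ)} {K : ℕ} {s : List ℕ}

theorem mem_moves {m : PDAMove} :
    m ∈ (automaton T K s).moves ↔ m = firstMove s ∨ IsMove T K m := by
  simp [automaton, mem_fixedMoves]

theorem wellFormed_automaton (hs : ∀ b ∈ s, b < K) : (automaton T K s).WellFormed := by
  refine ⟨by simp [automaton, bound], by simp [automaton, bound], by simp [automaton, bound],
    fun m hm => ?_⟩
  simp only [automaton, List.mem_cons] at hm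
  rcases hm with rfl | hm
  · refine ⟨by simp [automaton, bound, firstMove], by simp [automaton, bound, firstMove],
      by simp [automaton, bound, firstMove], by simp [automaton, bound, firstMove], ?_⟩
    intro X hX
    simp only [firstMove, symbol, List.mem_append, List.mem_map, List.mem_reverse,
      List.mem_singleton] at hX
    -- `bound` does not depend on `s`; its summand `K + 6` takes care of the symbols of `s`.
    simp only [automaton, bound]
    rcases hX with ⟨b, hb, rfl⟩ | rfl
    · have := hs b hb
      omega
    · omega
  · have hle : moveBound m ≤ bound T K := by
      have := List.single_le_sum (l := (fixedMoves T K).map moveBound) (by simp) _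
        (List.mem_map_of_mem hm)
      rw [bound]
      omega
    rw [moveBound] at hle
    simp only [automaton]
    refine ⟨by omega, by omega, by omega, fun a ha => ?_, fun X hX => ?_⟩
    · have : m.read.getD 0 = a := by simp [Option.mem_def.1 ha]
      omega
    · have := List.single_le_sum (l := m.push) (by simp) X hX
      omega

/-- Moves without reading start only in states `popState (b :: r)`, where no other kind of move
starts and the state determines the move. Elsewhere parity and size separate the markers `0, 1, 2`,
the odd tile letters and the even word letters. -/
theorem deterministic_automaton : (automaton T K s).Deterministic := by
  intro m₁ h₁ m₂ h₂ hsource htop hread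
  rw [mem_moves] at h₁ h₂
  rcases h₁ with rfl | h₁ <;> rcases h₂ with rfl | h₂
  · rfl
  · cases h₂ <;> simp [firstMove, popState] at hsource
  · cases h₁ <;> simp [firstMove, popState] at hsource
  · cases h₁ <;> cases h₂ <;>
      simp [popState, tileLetter, wordLetter, symbol] at hsource htop hread ⊢
    all_goals simp_all

theorem length_push_of_source {m : PDAMove} (hm : m ∈ (automaton T K s).moves) :
    (m.source < 4 → 1 ≤ m.push.length) ∧
      (4 ≤ m.source → 4 ≤ m.target ∧ m.push.length ≤ 1) := by
  rw [mem_moves] at hm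
  rcases hm with rfl | hm
  · simp [firstMove]
  · cases hm <;> simp [popState]

/-- States below 4 never lower the stack. States from 4 on never raise it and are never left, so
they absorb every computation after its first decrease. -/
theorem oneReversal_automaton : (automaton T K s).OneReversal := by
  have step : ∀ c d, (automaton T K s).Step c d → 4 ≤ c.state →
      4 ≤ d.state ∧ d.stack.length ≤ c.stack.length := by
    rintro _ _ ⟨m, hm, w, st⟩ h
    have := (length_push_of_source hm).2 h
    simp only [List.length_append, List.length_cons]
    omega
  intro w c₁ c₂ c₃ c₄ _ h₁₂ hdec h₂₃ h₃₄
  have h₂ : 4 ≤ c₂.state := by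
    obtain ⟨m, hm, w, st⟩ := h₁₂
    have := length_push_of_source hm
    simp only [List.length_append, List.length_cons] at hdec
    by_cases h : m.source < 4
    · have := this.1 h
      omega
    · exact (this.2 (by omega)).1
  have h₃ : 4 ≤ c₃.state := by
    clear h₃₄
    induction h₂₃ with
    | refl => exact h₂
    | tail _ h ih => exact (step _ _ h ih).1
  exact (step _ _ h₃₄ h₃).2

/-! ### Shape of the accepted words. -/

/-- What is accepted in state `4`. -/
def AcceptsLetters (i st : List ℕ) : Prop :=
  ∃ v st' : List ℕ, i = v.map wordLetter ++ [2] ∧ st = v.map symbol ++ 0 :: st'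

/-- What is accepted in state `popState r`. -/
def AcceptsPops (T : List (List ℕ × List ℕ)) (r i st : List ℕ) : Prop :=
  ∃ (I : List (List ℕ × List ℕ)) (i' st' : List ℕ), (∀ t ∈ I, t ∈ T) ∧
    i = I.map tileLetter ++ 1 :: i' ∧
    st = (r ++ I.flatMap Prod.fst).map symbol ++ 1 :: st' ∧ AcceptsLetters i' st'

/-- What is accepted in state `3`. -/
def AcceptsSecond (T : List (List ℕ × List ℕ)) (i st : List ℕ) : Prop :=
  ∃ i', i = 0 :: i' ∧ AcceptsPops T [] i' st

/-- What is accepted in state `2`. -/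
def AcceptsPushLetters (T : List (List ℕ × List ℕ)) (i st : List ℕ) : Prop :=
  ∃ v i' : List ℕ, i = v.map wordLetter ++ 2 :: i' ∧
    AcceptsSecond T i' (v.reverse.map symbol ++ st)

/-- What is accepted in state `1`. -/
def AcceptsPushTiles (T : List (List ℕ × List ℕ)) (i st : List ℕ) : Prop :=
  ∃ (I : List (List ℕ × List ℕ)) (i' : List ℕ), (∀ t ∈ I, t ∈ T) ∧
    i = I.map tileLetter ++ 1 :: i' ∧
    AcceptsPushLetters T i' (1 :: ((I.flatMap Prod.snd).reverse.map symbol ++ st))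

/-- What is accepted in state `0`. -/
def AcceptsFirst (T : List (List ℕ × List ℕ)) (s i st : List ℕ) : Prop :=
  ∃ i' st', i = 0 :: i' ∧ st = 0 :: st' ∧ AcceptsPushTiles T i' (s.reverse.map symbol ++ st)

/-- Induction backwards from the end of the computation: each move turns the description for its
target into the one for its source. All states are treated at once because a single computation
passes through several. -/
theorem accepts_of_reaches {c d : PDAConfig} (h : (automaton T K s).Reaches c d)
    (hd : d.state = 5) (hd' : d.input = []) :
    (c.state = 5 → c.input = []) ∧ (c.state = 4 → AcceptsLetters c.input c.stack) ∧
      (∀ r, c.state = popState r → AcceptsPops T r c.input c.stack) ∧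
      (c.state = 3 → AcceptsSecond T c.input c.stack) ∧
      (c.state = 2 → AcceptsPushLetters T c.input c.stack) ∧
      (c.state = 1 → AcceptsPushTiles T c.input c.stack) ∧
      (c.state = 0 → AcceptsFirst T s c.input c.stack) := by
  induction h using Relation.ReflTransGen.head_induction_on with
  | refl => simp [hd, hd', popState]
  | head h _ ih =>
    obtain ⟨m, hm, w, st⟩ := h
    rw [mem_moves] at hm
    rcases hm with rfl | hm
    · simp only [firstMove, popState] at ih ⊢
      simp at ih ⊢
      exact ⟨w, st, rfl, rfl, by simpa using ih⟩
    cases hm with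
    | pushTile t ht X hX =>
      simp [popState] at ih ⊢
      obtain ⟨I, i', hI, rfl, h⟩ := ih
      exact ⟨t :: I, i', by simpa [ht] using hI, by simp, by simpa using h⟩
    | pushSeparator X hX =>
      simp [popState] at ih ⊢
      exact ⟨[], w, by simp, by simp, by simpa using ih⟩
    | pushLetter b hb X hX =>
      simp [popState] at ih ⊢
      obtain ⟨v, i', rfl, h⟩ := ih
      exact ⟨b :: v, i', by simp, by simpa using h⟩
    | endFirst X hX =>
      simp [popState] at ih ⊢
      exact ⟨[], w, by simp, by simpa using ih⟩
    | beginSecond X hX =>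
      simp [popState] at ih ⊢
      exact ⟨w, rfl, ih [] rfl⟩
    | readTile t ht X hX =>
      simp [popState] at ih ⊢
      rintro r hr
      obtain rfl : r = [] := Encodable.encode_injective (by simpa using hr)
      obtain ⟨I, i', st', hI, rfl, hst, h⟩ := ih
      exact ⟨t :: I, i', st', by simpa [ht] using hI, by simp, by simpa using hst, h⟩
    | popTile t ht b r hr =>
      simp [popState] at ih ⊢
      rintro r' hr'
      obtain rfl : r' = b :: r := Encodable.encode_injective (by simpa using hr'.symm)
      obtain ⟨I, i', st', hI, rfl, hst, h⟩ := ih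
      exact ⟨I, i', st', hI, by simp, by simpa using hst, h⟩
    | popSeparator =>
      simp [popState] at ih ⊢
      rintro r hr
      obtain rfl : r = [] := Encodable.encode_injective (by simpa using hr)
      exact ⟨[], w, st, by simp, by simp, by simp, ih⟩
    | popLetter b hb =>
      simp [popState] at ih ⊢
      obtain ⟨v, st', rfl, rfl⟩ := ih
      exact ⟨b :: v, st', by simp, by simp⟩
    | endSecond =>
      simp [popState] at ih ⊢
      exact ⟨[], st, by simp [ih], by simp⟩

theorem tileLetter_injective : Function.Injective tileLetter := by
  intro t u h
  simpa [tileLetter] using h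

theorem wordLetter_injective : Function.Injective wordLetter := by
  intro a b h
  simpa [wordLetter] using h

theorem symbol_injective : Function.Injective symbol := by
  intro a b h
  simpa [symbol] using h

theorem exists_of_mem_language {x : List ℕ} (h : x ∈ (automaton T K s).language) :
    ∃ (I J : List (List ℕ × List ℕ)) (v v' : List ℕ), (∀ t ∈ I, t ∈ T) ∧
      x = 0 :: ((I.map tileLetter ++ 1 :: v.map wordLetter) ++ 2 :: 0 ::
        ((J.map tileLetter ++ 1 :: v'.map wordLetter) ++ [2])) ∧
      v.reverse = J.flatMap Prod.fst ∧ v'.reverse = s ++ I.flatMap Prod.snd := by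
  obtain ⟨q, hq, st, h⟩ := h
  obtain rfl : q = 5 := by simpa [automaton] using hq
  obtain ⟨i₁, st₁, hx, hst₁, I, i₂, hI, rfl, v, i₃, rfl, i₄, rfl, J, i₅, st₂, -, rfl, hst₂, v', st₃,
    rfl, rfl⟩ := (accepts_of_reaches h rfl rfl).2.2.2.2.2.2 rfl
  have hone : ∀ l : List ℕ, 1 ∉ l.map symbol := by simp [symbol]
  have hzero : ∀ l : List ℕ, 0 ∉ l.map symbol := by simp [symbol]
  have hst : (automaton T K s).initial x = ⟨0, x, [0]⟩ := rfl
  simp only [hst] at hx hst₁ hst₂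
  -- Both descriptions of the stack are cut at the separator `1`, and below at the bottom symbol
  -- `0`.
  obtain ⟨h₁, -, h₂⟩ := List.append_cons_inj_of_not_mem_right hst₂.symm (hone _)
    (by simp [symbol])
  obtain ⟨h₃, -, -⟩ := List.append_cons_inj_of_not_mem_right
    (h₂.trans (List.append_assoc _ _ _).symm) (by simp [symbol]) (by simp)
  refine ⟨I, J, v, v', hI, by simpa using hx, ?_, ?_⟩
  · simpa using symbol_injective.list_map h₁.symm
  · rw [← List.map_append] at h₃
    simp [symbol_injective.list_map h₃]

/-! ### The accepting computation for a match. -/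

theorem step_of_isMove {m : PDAMove} (h : IsMove T K m) (w st : List ℕ) :
    (automaton T K s).Step ⟨m.source, m.read.toList ++ w, m.top :: st⟩
      ⟨m.target, w, m.push ++ st⟩ :=
  .move m (mem_moves.2 (.inr h)) w st

theorem reaches_pushTiles (hT : ∀ t ∈ T, ∀ b ∈ t.2, b < K) (w : List ℕ)
    {I : List (List ℕ × List ℕ)} (hI : ∀ t ∈ I, t ∈ T) :
    ∀ {st : List ℕ}, st ≠ [] → (∀ X ∈ st, X < K + 2) →
    (automaton T K s).Reaches ⟨1, I.map tileLetter ++ w, st⟩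
      ⟨1, w, (I.flatMap Prod.snd).reverse.map symbol ++ st⟩ := by
  induction I with
  | nil => exact fun _ _ => .refl
  | cons t I ih =>
    intro st hne hst
    obtain ⟨X, st, rfl⟩ := List.exists_cons_of_ne_nil hne
    have ht := hI t (by simp)
    refine .head (step_of_isMove (.pushTile t ht X (hst X (by simp))) _ st) ?_
    have := ih (fun u hu => hI u (by simp [hu])) (st := t.2.reverse.map symbol ++ X :: st)
      (by simp) ?_
    · simpa [PDA.Reaches] using this
    · intro Y hY
      simp only [List.mem_append, List.mem_map, List.mem_reverse] at hY
      rcases hY with ⟨b, hb, rfl⟩ | hY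
      · have := hT t ht b hb
        rw [symbol]
        omega
      · exact hst Y hY

theorem reaches_pushLetters (w : List ℕ) {v : List ℕ} (hv : ∀ b ∈ v, b < K) :
    ∀ {st : List ℕ}, st ≠ [] → (∀ X ∈ st, X < K + 2) →
    (automaton T K s).Reaches ⟨2, v.map wordLetter ++ w, st⟩
      ⟨2, w, v.reverse.map symbol ++ st⟩ := by
  induction v with
  | nil => exact fun _ _ => .refl
  | cons b v ih =>
    intro st hne hst
    obtain ⟨X, st, rfl⟩ := List.exists_cons_of_ne_nil hne
    have hb := hv b (by simp)
    refine .head (step_of_isMove (.pushLetter b hb X (hst X (by simp))) _ st) ?_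
    have := ih (fun u hu => hv u (by simp [hu])) (st := symbol b :: X :: st) (by simp) ?_
    · simpa [PDA.Reaches] using this
    · intro Y hY
      rcases List.mem_cons.1 hY with rfl | hY
      · rw [symbol]
        omega
      · exact hst Y hY

theorem reaches_popTile {t : List ℕ × List ℕ} (ht : t ∈ T) (w st : List ℕ) {r : List ℕ}
    (hr : r <:+ t.1) :
    (automaton T K s).Reaches ⟨popState r, w, r.map symbol ++ st⟩ ⟨popState [], w, st⟩ := by
  induction r with
  | nil => exact .refl
  | cons b r ih =>
    exact .head (step_of_isMove (.popTile t ht b r hr) _ _) (ih ((List.suffix_cons b r).trans hr))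

theorem reaches_popTiles (hT : ∀ t ∈ T, ∀ b ∈ t.1, b < K) (w : List ℕ) {st : List ℕ}
    (hne : st ≠ []) (hst : ∀ X ∈ st, X < K + 2)
    {I : List (List ℕ × List ℕ)} (hI : ∀ t ∈ I, t ∈ T) :
    (automaton T K s).Reaches
      ⟨popState [], I.map tileLetter ++ w, (I.flatMap Prod.fst).map symbol ++ st⟩
      ⟨popState [], w, st⟩ := by
  induction I with
  | nil => exact .refl
  | cons t I ih =>
    have ht := hI t (by simp)
    have key : ∀ st', st' ≠ [] → (∀ X ∈ st', X < K + 2) → (automaton T K s).Step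
        ⟨popState [], tileLetter t :: (I.map tileLetter ++ w), st'⟩
        ⟨popState t.1, I.map tileLetter ++ w, st'⟩ := by
      intro st' hne hst
      obtain ⟨X, st', rfl⟩ := List.exists_cons_of_ne_nil hne
      exact step_of_isMove (.readTile t ht X (hst X (by simp))) _ _
    refine .head (key _ (by simp [hne]) ?_) ?_
    · intro X hX
      simp only [List.mem_append, List.mem_map, List.mem_flatMap] at hX
      rcases hX with ⟨b, ⟨u, hu, hb⟩, rfl⟩ | hX
      · have := hT u (hI u hu) b hb
        rw [symbol]
        omega
      · exact hst X hX
    · have := reaches_popTile (K := K) (s := s) ht (I.map tileLetter ++ w)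
        ((I.flatMap Prod.fst).map symbol ++ st) (List.suffix_refl _)
      simp only [List.flatMap_cons, List.map_append, List.append_assoc]
      exact this.trans (ih fun u hu => hI u (by simp [hu]))

theorem reaches_popLetters (w st : List ℕ) {v : List ℕ} (hv : ∀ b ∈ v, b < K) :
    (automaton T K s).Reaches ⟨4, v.map wordLetter ++ w, v.map symbol ++ st⟩ ⟨4, w, st⟩ := by
  induction v with
  | nil => exact .refl
  | cons b v ih =>
    exact .head (step_of_isMove (.popLetter b (hv b (by simp))) _ _)
      (ih fun u hu => hv u (by simp [hu]))

theorem mem_language_of_match (hT : ∀ t ∈ T, ∀ b ∈ t.1 ++ t.2, b < K) (hs : ∀ b ∈ s, b < K)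
    {I : List (List ℕ × List ℕ)} (hI : ∀ t ∈ I, t ∈ T)
    (h : I.flatMap Prod.fst = s ++ I.flatMap Prod.snd) {w : List ℕ}
    (hw : w = 0 :: (I.map tileLetter ++
      1 :: ((I.flatMap Prod.fst).reverse.map wordLetter ++ [2]))) :
    w ++ w ∈ (automaton T K s).language := by
  have hT₁ : ∀ t ∈ T, ∀ b ∈ t.1, b < K := fun t ht b hb => hT t ht b (by simp [hb])
  have hT₂ : ∀ t ∈ T, ∀ b ∈ t.2, b < K := fun t ht b hb => hT t ht b (by simp [hb])
  have hv : ∀ b ∈ (I.flatMap Prod.fst).reverse, b < K := by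
    simp only [List.mem_reverse, List.mem_flatMap]
    rintro b ⟨t, ht, hb⟩
    exact hT₁ t (hI t ht) b hb
  have hsymbol : ∀ {b}, b < K → symbol b < K + 2 := fun hb => Nat.add_lt_add_right hb 2
  set st₁ : List ℕ := s.reverse.map symbol ++ [0] with hst₁
  set st₂ : List ℕ := (I.flatMap Prod.snd).reverse.map symbol ++ st₁ with hst₂
  have bound₁ : ∀ X ∈ st₁, X < K + 2 := by
    simp only [hst₁, List.mem_append, List.mem_map, List.mem_reverse, List.mem_singleton]
    rintro X (⟨b, hb, rfl⟩ | rfl)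
    · exact hsymbol (hs b hb)
    · omega
  have bound₂ : ∀ X ∈ 1 :: st₂, X < K + 2 := by
    simp only [hst₂, List.mem_cons, List.mem_append, List.mem_map, List.mem_reverse,
      List.mem_flatMap]
    rintro X (rfl | ⟨b, ⟨t, ht, hb⟩, rfl⟩ | hX)
    · omega
    · exact hsymbol (hT₂ t (hI t ht) b hb)
    · exact bound₁ X hX
  have bound₃ : ∀ X ∈ (I.flatMap Prod.fst).map symbol ++ 1 :: st₂, X < K + 2 := by
    intro X hX
    rcases List.mem_append.1 hX with hX | hX
    · obtain ⟨b, hb, rfl⟩ := List.mem_map.1 hX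
      exact hsymbol (hv b (by simpa using hb))
    · exact bound₂ X hX
  have withTop : ∀ (st : List ℕ), st ≠ [] → (∀ X ∈ st, X < K + 2) →
      ∃ X st', st = X :: st' ∧ X < K + 2 := by
    intro st hne hst
    obtain ⟨X, st, rfl⟩ := List.exists_cons_of_ne_nil hne
    exact ⟨X, st, rfl, hst X (by simp)⟩
  -- The match equation enters here: the stack below the separator spells the very word that the
  -- second half is about to read.
  have hst₂' : st₂ = (I.flatMap Prod.fst).reverse.map symbol ++ [0] := by
    rw [hst₂, hst₁, h]
    simp
  refine ⟨5, by simp [automaton], [0], ?_⟩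
  have first : (automaton T K s).Reaches ((automaton T K s).initial (w ++ w))
      ⟨2, [2] ++ w, (I.flatMap Prod.fst).map symbol ++ 1 :: st₂⟩ := by
    refine .head (b := ⟨1, I.map tileLetter ++
      1 :: ((I.flatMap Prod.fst).reverse.map wordLetter ++ ([2] ++ w)), st₁⟩) ?_ ?_
    · have := PDA.Step.move (M := automaton T K s) (firstMove s) (mem_moves.2 (.inl rfl))
        (I.map tileLetter ++ 1 :: ((I.flatMap Prod.fst).reverse.map wordLetter ++ ([2] ++ w))) []
      have hww : w ++ w = 0 :: (I.map tileLetter ++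
          1 :: ((I.flatMap Prod.fst).reverse.map wordLetter ++ ([2] ++ w))) := by
        nth_rewrite 1 [hw]
        simp
      rw [hww]
      rw [List.append_nil] at this
      exact this
    refine (reaches_pushTiles hT₂ _ hI (by simp [hst₁]) bound₁).trans ?_
    obtain ⟨X, st, hX, hlt⟩ := withTop st₂ (by simp [hst₂, hst₁])
      fun X hX => bound₂ X (List.mem_cons_of_mem _ hX)
    have push := step_of_isMove (s := s) (IsMove.pushSeparator (T := T) X hlt)
      ((I.flatMap Prod.fst).reverse.map wordLetter ++ ([2] ++ w)) st
    simp only [Option.toList_some, List.cons_append, List.nil_append, ← hX] at push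
    refine .head push ?_
    have := reaches_pushLetters (T := T) (s := s) ([2] ++ w) hv (st := 1 :: st₂) (by simp) bound₂
    simpa [PDA.Reaches] using this
  have middle : (automaton T K s).Reaches
      ⟨2, [2] ++ w, (I.flatMap Prod.fst).map symbol ++ 1 :: st₂⟩
      ⟨popState [], I.map tileLetter ++ 1 :: ((I.flatMap Prod.fst).reverse.map wordLetter ++ [2]),
        (I.flatMap Prod.fst).map symbol ++ 1 :: st₂⟩ := by
    obtain ⟨X, st, hX, hlt⟩ := withTop _ (by simp) bound₃
    rw [hX, hw]
    exact .head (step_of_isMove (.endFirst X hlt) _ st)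
      (.single (step_of_isMove (.beginSecond X hlt) _ st))
  refine first.trans (middle.trans ?_)
  refine (reaches_popTiles hT₁ _ (by simp) bound₂ hI).trans ?_
  refine .head (step_of_isMove .popSeparator _ _) ?_
  rw [List.nil_append, hst₂']
  exact (reaches_popLetters _ _ hv).tail (step_of_isMove .endSecond [] [])

/-- Equality of the two halves identifies `I` with `J` and `v` with `v'`, so the two stack
conditions combine into the match equation. -/
theorem containsSelfShuffle_automaton_iff (hT : ∀ t ∈ T, ∀ b ∈ t.1 ++ t.2, b < K)
    (hs : ∀ b ∈ s, b < K) :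
    ContainsSelfShuffle (automaton T K s).language ↔ HasMatch {t | t ∈ T} s := by
  constructor
  · rintro ⟨w, x, hx, hxL⟩
    obtain ⟨I, J, v, v', hI, rfl, h₁, h₂⟩ := exists_of_mem_language hxL
    have h := eq_of_mem_wordShuffle_self (by simp) (by simp [tileLetter, wordLetter])
      (by simp [tileLetter, wordLetter]) (by simp [tileLetter, wordLetter])
      (by simp [tileLetter, wordLetter]) hx
    obtain ⟨hIJ, -, hvv⟩ := List.append_cons_inj_of_not_mem_right h (by simp [tileLetter])
      (by simp [wordLetter])
    obtain rfl := tileLetter_injective.list_map hIJ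
    obtain rfl := wordLetter_injective.list_map hvv
    exact ⟨I, hI, h₁.symm.trans h₂⟩
  · rintro ⟨I, hI, h⟩
    exact ⟨_, _, append_self_mem_wordShuffle _, mem_language_of_match hT hs hI h rfl⟩

end MatchPDA

/-! ### Simulation of Turing machines by string rewriting -/

open Turing

/-- The letters of the words that represent configurations of a Turing machine. -/
inductive ConfigLetter (Γ Λ : Type*)
  | tape (a : Γ)
  | state (q : Λ)
  | leftEnd
  | rightEnd
  | halted
  | sep

namespace ConfigLetter

instance {Γ Λ : Type*} [Finite Γ] [Finite Λ] : Finite (ConfigLetter Γ Λ) := by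
  refine Finite.of_injective (β := Γ ⊕ Λ ⊕ Fin 4) (fun
    | tape a => .inl a
    | state q => .inr (.inl q)
    | leftEnd => .inr (.inr 0)
    | rightEnd => .inr (.inr 1)
    | halted => .inr (.inr 2)
    | sep => .inr (.inr 3)) ?_
  rintro (_ | _ | _ | _ | _ | _) (_ | _ | _ | _ | _ | _) <;> simp

end ConfigLetter

section TuringMachine

open ConfigLetter

variable {Γ Λ : Type*} [Inhabited Γ]

/-- The word for the configuration in state `q`, with `L` (reversed) to the left of the head and
`R` from the head on. -/
def configWord {S : Set Λ} (q : S) (L R : List Γ) : List (ConfigLetter Γ S) :=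
  leftEnd :: (L.reverse.map tape) ++ state q :: (R.map tape ++ [rightEnd])

/-- The configuration represented by `configWord`. -/
def listConfig {S : Set Λ} (q : S) (L R : List Γ) : TM0.Cfg Γ Λ :=
  ⟨q.1, Tape.mk' (ListBlank.mk L) (ListBlank.mk R)⟩

theorem sep_notMem_configWord {S : Set Λ} (q : S) (L R : List Γ) : sep ∉ configWord q L R := by
  simp [configWord]

theorem listConfig_nil {S : Set Λ} (q : S) (L : List Γ) :
    listConfig q L [] = listConfig q L [default] := by
  have : (ListBlank.mk [] : ListBlank Γ) = ListBlank.mk [default] :=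
    Quotient.sound' (.inl ⟨1, rfl⟩)
  rw [listConfig, this, listConfig]

variable [Inhabited Λ]

/-- The rewriting rules that simulate the machine `M` restricted to the states in `S`. -/
inductive MachineRule (M : TM0.Machine Γ Λ) (S : Set Λ) :
    List (ConfigLetter Γ S) × List (ConfigLetter Γ S) → Prop
  | right (q q' : S) (a : Γ) (h : M q a = some (q'.1, .move .right)) :
      MachineRule M S ([state q, tape a], [tape a, state q'])
  | left (q q' : S) (a b : Γ) (h : M q a = some (q'.1, .move .left)) :
      MachineRule M S ([tape b, state q, tape a], [state q', tape b, tape a])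
  | leftBlank (q q' : S) (a : Γ) (h : M q a = some (q'.1, .move .left)) :
      MachineRule M S ([leftEnd, state q, tape a], [leftEnd, state q', tape default, tape a])
  | write (q q' : S) (a b : Γ) (h : M q a = some (q'.1, .write b)) :
      MachineRule M S ([state q, tape a], [state q', tape b])
  | halt (q : S) (a : Γ) (h : M q a = none) :
      MachineRule M S ([state q, tape a], [halted])
  | rightBlank (q : S) :
      MachineRule M S ([state q, rightEnd], [state q, tape default, rightEnd])

variable {M : TM0.Machine Γ Λ} {S : Set Λ}

theorem finite_machineRule [Finite Γ] [Finite S] : {t | MachineRule M S t}.Finite := by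
  -- The longest side of a rule is the right side of `leftBlank`, of length 4.
  refine ((List.finite_length_le _ 4).prod (List.finite_length_le _ 4)).subset ?_
  rintro _ (_ | _ | _ | _ | _ | _) <;> simp

theorem MachineRule.sep_notMem {t : List (ConfigLetter Γ S) × List (ConfigLetter Γ S)}
    (h : MachineRule M S t) : sep ∉ t.1 ∧ sep ∉ t.2 := by
  cases h <;> simp

/-- All rules but `rightBlank` need an explicit letter under the head. `rightBlank` supplies a
blank, which leaves the represented configuration unchanged. -/
theorem derives_configWord_cons (q : S) (L R : List Γ) :
    ∃ a R', Derives {t | MachineRule M S t} (configWord q L R) (configWord q L (a :: R')) ∧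
      listConfig q L R = listConfig q L (a :: R') := by
  cases R with
  | nil =>
    refine ⟨default, [], .single ⟨leftEnd :: L.reverse.map tape, [], _, .rightBlank q, ?_, ?_⟩,
      listConfig_nil q L⟩ <;> simp [configWord]
  | cons a R => exact ⟨a, R, .refl, rfl⟩

theorem exists_rewrites_of_step (hS : TM0.Supports M S) (q : S) (L : List Γ) (a : Γ)
    (R : List Γ) {c : TM0.Cfg Γ Λ} (h : c ∈ TM0.step M (listConfig q L (a :: R))) :
    ∃ (q' : S) (L' R' : List Γ), Rewrites {t | MachineRule M S t} (configWord q L (a :: R))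
      (configWord q' L' R') ∧ c = listConfig q' L' R' := by
  obtain ⟨⟨q', s⟩, hM, rfl⟩ := Option.map_eq_some_iff.1 h
  simp only [Tape.mk'_head, ListBlank.head_mk, List.headI_cons] at hM
  obtain ⟨q', rfl⟩ : ∃ q'' : S, q' = q''.1 := ⟨⟨q', hS.2 hM q.2⟩, rfl⟩
  match s, hM with
  | .move .right, hM =>
    refine ⟨q', a :: L, R, ⟨leftEnd :: L.reverse.map tape, R.map tape ++ [rightEnd], _,
      .right q q' a hM, ?_, ?_⟩, ?_⟩
    · simp [configWord]
    · simp [configWord]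
    · simp [listConfig]
  | .move .left, hM =>
    cases L with
    | nil =>
      refine ⟨q', [], default :: a :: R, ⟨[], R.map tape ++ [rightEnd], _,
        .leftBlank q q' a hM, ?_, ?_⟩, ?_⟩
      · simp [configWord]
      · simp [configWord]
      · simp [listConfig]
    | cons b L =>
      refine ⟨q', L, b :: a :: R, ⟨leftEnd :: L.reverse.map tape, R.map tape ++ [rightEnd], _,
        .left q q' a b hM, ?_, ?_⟩, ?_⟩
      · simp [configWord]
      · simp [configWord]
      · simp [listConfig]
  | .write b, hM =>
    refine ⟨q', L, b :: R, ⟨leftEnd :: L.reverse.map tape, R.map tape ++ [rightEnd], _,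
      .write q q' a b hM, ?_, ?_⟩, ?_⟩
    · simp [configWord]
    · simp [configWord]
    · simp [listConfig]

theorem exists_derives_halted_of_dom (hS : TM0.Supports M S) {c d : TM0.Cfg Γ Λ}
    (hcd : StateTransition.Reaches (TM0.step M) c d) (hd : TM0.step M d = none) :
    ∀ (q : S) (L R : List Γ), c = listConfig q L R →
      ∃ v, Derives {t | MachineRule M S t} (configWord q L R) v ∧ halted ∈ v := by
  induction hcd using Relation.ReflTransGen.head_induction_on with
  | refl =>
    rintro q L R rfl
    obtain ⟨a, R, hR, h⟩ := derives_configWord_cons (M := M) q L R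
    rw [h] at hd
    have hM : M q a = none := by simpa [TM0.step, listConfig] using hd
    exact ⟨_, hR.tail ⟨leftEnd :: L.reverse.map tape, R.map tape ++ [rightEnd], _, .halt q a hM,
      by simp [configWord], rfl⟩, by simp⟩
  | head h _ ih =>
    rintro q L R rfl
    obtain ⟨a, R, hR, hc⟩ := derives_configWord_cons (M := M) q L R
    rw [hc] at h
    obtain ⟨q', L', R', hq', rfl⟩ := exists_rewrites_of_step hS q L a R h
    obtain ⟨v, hv, hmem⟩ := ih q' L' R' rfl
    exact ⟨v, hR.trans (hv.head hq'), hmem⟩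

/-- A configuration word has a single state letter and every rule contains one on its left side, so
the place of application is forced. `rightBlank` corresponds to no machine step, hence `Reaches`
instead of a step. -/
theorem step_of_rewrites {q : S} {L R : List Γ} {v : List (ConfigLetter Γ S)}
    (h : Rewrites {t | MachineRule M S t} (configWord q L R) v) :
    TM0.step M (listConfig q L R) = none ∨
    ∃ (q' : S) (L' R' : List Γ), v = configWord q' L' R' ∧
      StateTransition.Reaches (TM0.step M) (listConfig q L R) (listConfig q' L' R') := by
  obtain ⟨p, s, t, ht, hu, rfl⟩ := h
  have split : ∀ (q₀ : S) (x y : List (ConfigLetter Γ S)), configWord q L R = x ++ state q₀ :: y →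
      leftEnd :: L.reverse.map tape = x ∧ q = q₀ ∧ R.map tape ++ [rightEnd] = y := by
    intro q₀ x y h
    have := List.append_cons_inj_of_not_mem_right h.symm (by simp) (by simp)
    simp_all
  have splitTape : ∀ (a : Γ) (y : List (ConfigLetter Γ S)),
      R.map tape ++ [rightEnd] = tape a :: y →
      ∃ R', R = a :: R' ∧ R'.map tape ++ [rightEnd] = y := by
    intro a y h
    cases R <;> simp_all
  cases ht with
  | right q₀ q' a hM =>
    obtain ⟨rfl, rfl, h⟩ := split q₀ p (tape a :: s) (by simpa using hu)
    obtain ⟨R, rfl, rfl⟩ := splitTape _ _ h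
    refine .inr ⟨q', a :: L, R, by simp [configWord], .single ?_⟩
    simp [TM0.step, listConfig, hM]
  | left q₀ q' a b hM =>
    obtain ⟨hp, rfl, h⟩ := split q₀ (p ++ [tape b]) (tape a :: s) (by simpa using hu)
    obtain ⟨R, rfl, rfl⟩ := splitTape _ _ h
    cases L with
    | nil =>
      rcases p with _ | ⟨_, _⟩ <;> simp at hp
    | cons b' L =>
      simp only [List.reverse_cons, List.map_append, List.map_cons, List.map_nil,
        ← List.cons_append] at hp
      obtain ⟨rfl, hb⟩ := List.append_inj' hp rfl
      obtain rfl : b' = b := by simpa using hb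
      refine .inr ⟨q', L, b' :: a :: R, by simp [configWord], .single ?_⟩
      simp [TM0.step, listConfig, hM]
  | leftBlank q₀ q' a hM =>
    obtain ⟨hp, rfl, h⟩ := split q₀ (p ++ [leftEnd]) (tape a :: s) (by simpa using hu)
    obtain ⟨R, rfl, rfl⟩ := splitTape _ _ h
    -- `leftEnd` occurs only as the first letter of a configuration word.
    obtain ⟨rfl, rfl⟩ : p = [] ∧ L = [] := by
      cases p with
      | nil => simp_all
      | cons x p =>
        have : leftEnd ∈ L.reverse.map (tape : Γ → ConfigLetter Γ S) := by simp_all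
        simp at this
    refine .inr ⟨q', [], default :: a :: R, by simp [configWord], .single ?_⟩
    simp [TM0.step, listConfig, hM]
  | write q₀ q' a b hM =>
    obtain ⟨rfl, rfl, h⟩ := split q₀ p (tape a :: s) (by simpa using hu)
    obtain ⟨R, rfl, rfl⟩ := splitTape _ _ h
    refine .inr ⟨q', L, b :: R, by simp [configWord], .single ?_⟩
    simp [TM0.step, listConfig, hM]
  | halt q₀ a hM =>
    obtain ⟨rfl, rfl, h⟩ := split q₀ p (tape a :: s) (by simpa using hu)
    obtain ⟨R, rfl, rfl⟩ := splitTape _ _ h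
    exact .inl (by simp [TM0.step, listConfig, hM])
  | rightBlank q₀ =>
    obtain ⟨rfl, rfl, h⟩ := split q₀ p (rightEnd :: s) (by simpa using hu)
    obtain ⟨rfl, rfl⟩ : R = [] ∧ s = [] := by cases R <;> simp_all
    exact .inr ⟨q, L, [default], by simp [configWord], listConfig_nil q L ▸ .refl⟩

theorem exists_derives_halted_iff (hS : TM0.Supports M S) (l : List Γ) :
    (∃ v, Derives {t | MachineRule M S t} (configWord ⟨default, hS.1⟩ [] l) v ∧ halted ∈ v) ↔
      (TM0.eval M l).Dom := by
  have hinit : (TM0.init l : TM0.Cfg Γ Λ) = listConfig (S := S) ⟨default, hS.1⟩ [] l := rfl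
  have hdom : (TM0.eval M l).Dom ↔ ∃ d, StateTransition.Reaches (TM0.step M)
      (listConfig (S := S) ⟨default, hS.1⟩ [] l) d ∧ TM0.step M d = none := by
    rw [← hinit]
    change (StateTransition.eval (TM0.step M) (TM0.init l)).Dom ↔ _
    rw [Part.dom_iff_mem]
    simp only [StateTransition.mem_eval]
  rw [hdom]
  constructor
  · rintro ⟨v, hv, hmem⟩
    -- If the machine runs forever, only configuration words are derivable, and these do not contain
    -- `halted`.
    by_contra hcon
    have : ∃ (q : S) (L R : List Γ), v = configWord q L R ∧ StateTransition.Reaches (TM0.step M)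
        (listConfig (S := S) ⟨default, hS.1⟩ [] l) (listConfig q L R) := by
      clear hmem
      induction hv with
      | refl => exact ⟨_, _, _, rfl, .refl⟩
      | tail _ h ih =>
        obtain ⟨q, L, R, rfl, hr⟩ := ih
        rcases step_of_rewrites h with hn | ⟨q', L', R', rfl, hr'⟩
        · exact absurd ⟨_, hr, hn⟩ hcon
        · exact ⟨q', L', R', rfl, hr.trans hr'⟩
    obtain ⟨q, L, R, rfl, -⟩ := this
    simp [configWord] at hmem
  · rintro ⟨d, hd, hn⟩
    exact exists_derives_halted_of_dom hS hd hn _ _ _ rfl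

end TuringMachine

/-! ### A universal machine with unary input -/

section Universal

open Turing

theorem finite_stackMachineLetter {K : Type*} [Finite K] {Γ : K → Type*} [∀ k, Finite (Γ k)] :
    Finite (TM2to1.Γ' K Γ) :=
  inferInstanceAs (Finite (Bool × ∀ k, Option (Γ k)))

theorem TM2.exists_TM0 {K : Type} [DecidableEq K] {Γ : K → Type} {Λ σ : Type} [Inhabited Λ]
    [Inhabited σ] [Fintype σ] (M : Λ → TM2.Stmt Γ Λ σ) {S : Finset Λ} (hS : TM2.Supports M S)
    (k : K) :
    ∃ (Λ' : Type) (_ : Inhabited Λ') (N : TM0.Machine (TM2to1.Γ' K Γ) Λ') (S' : Set Λ'),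
      S'.Finite ∧ TM0.Supports N S' ∧ ∀ L, (TM0.eval N (TM2to1.trInit k L)).Dom ↔
        (TM2.eval M k L).Dom := by
  classical
  refine ⟨_, inferInstance, TM1to0.tr (TM2to1.tr M), _, Finset.finite_toSet _,
    TM1to0.tr_supports _ (TM2to1.tr_supports M hS), fun L => ?_⟩
  rw [TM1to0.tr_eval, TM2to1.tr_eval_dom]

/-- Inputs are written in binary, least significant digit first; powers of two make this notation
unary up to one fixed digit. -/
theorem PartrecToTM2.trNat_two_pow (n : ℕ) :
    PartrecToTM2.trNat (2 ^ n) = List.replicate n .bit0 ++ [.bit1] := by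
  have key : ∀ n : ℕ, ((2 ^ n : ℕ) : Num) = Num.pos (PosNum.bit0^[n] PosNum.one) := by
    intro n
    induction n with
    | zero => rfl
    | succ n ih =>
      rw [pow_succ, mul_two, Nat.cast_add, ih, Num.bit0_of_bit0, Function.iterate_succ_apply']
      rfl
  rw [PartrecToTM2.trNat, key, PartrecToTM2.trNum]
  induction n with
  | zero => rfl
  | succ n ih => rw [Function.iterate_succ_apply', PartrecToTM2.trPosNum, ih]; rfl

instance : Finite PartrecToTM2.K' :=
  Finite.of_surjective (fun n : Fin 4 =>
    match n with
    | 0 => PartrecToTM2.K'.main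
    | 1 => .rev
    | 2 => .aux
    | 3 => .stack) (by rintro (_ | _ | _ | _); exacts [⟨0, rfl⟩, ⟨1, rfl⟩, ⟨2, rfl⟩, ⟨3, rfl⟩])

/-- Partial recursive functions of powers of two are computed, as to halting, by Turing machines
whose input is essentially unary. -/
theorem Partrec.exists_TM0 {f : ℕ →. ℕ} (hf : Partrec f) :
    ∃ (Γ Λ : Type) (_ : Inhabited Γ) (_ : Inhabited Λ) (M : TM0.Machine Γ Λ) (S : Set Λ)
      (l : List Γ) (c : Γ), Finite Γ ∧ S.Finite ∧ TM0.Supports M S ∧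
      ∀ n, (TM0.eval M (l ++ List.replicate n c)).Dom ↔ (f (2 ^ n)).Dom := by
  obtain ⟨c, hc⟩ := ToPartrec.Code.exists_code (Nat.Partrec'.part_iff₁.2 hf)
  -- Machines start in the default state, which is therefore chosen as the entry point of the code.
  let inst : Inhabited PartrecToTM2.Λ' := ⟨PartrecToTM2.trNormal c PartrecToTM2.Cont'.halt⟩
  obtain ⟨Λ, _, M, S, hfin, hS, h⟩ := TM2.exists_TM0 (σ := Option PartrecToTM2.Γ')
    PartrecToTM2.tr (PartrecToTM2.tr_supports c .halt) PartrecToTM2.K'.main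
  let cell : PartrecToTM2.Γ' → TM2to1.Γ' PartrecToTM2.K' fun _ => PartrecToTM2.Γ' :=
    fun x => (false, Function.update (fun _ => Option.none) .main (some x))
  -- The tape lists the stack from its bottom, so the separator, whose cell bears the bottom mark
  -- `true`, and the digit 1 precede the zeros.
  have hword : ∀ n, TM2to1.trInit (Γ := fun _ => PartrecToTM2.Γ') PartrecToTM2.K'.main
      (PartrecToTM2.trList [2 ^ n]) =
      ([(true, (cell .cons).2), cell .bit1] : List (TM2to1.Γ' _ _)) ++
        List.replicate n (cell .bit0) := by
    intro n
    simp only [PartrecToTM2.trList, PartrecToTM2.trNat_two_pow, TM2to1.trInit]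
    rw [show List.replicate n (cell .bit0) = (List.replicate n .bit0).map cell by simp]
    simp only [List.reverse_append, List.reverse_cons, List.reverse_nil, List.reverse_replicate]
    rfl
  refine ⟨_, Λ, inferInstance, inferInstance, M, S, _, _, finite_stackMachineLetter, hfin, hS,
    fun n => (hword n ▸ h (PartrecToTM2.trList [2 ^ n])).trans ?_⟩
  have hinit : (TM2.init PartrecToTM2.K'.main (PartrecToTM2.trList [2 ^ n]) :
      TM2.Cfg (fun _ => PartrecToTM2.Γ') PartrecToTM2.Λ' (Option PartrecToTM2.Γ')) =
      PartrecToTM2.init c [2 ^ n] := by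
    rw [TM2.init, PartrecToTM2.init]
    congr
    funext k
    cases k <;> rfl
  change (StateTransition.eval (TM2.step PartrecToTM2.tr)
    (TM2.init PartrecToTM2.K'.main (PartrecToTM2.trList [2 ^ n]))).Dom ↔ _
  rw [hinit, PartrecToTM2.tr_eval]
  have := hc ⟨[2 ^ n], rfl⟩
  simp only at this
  rw [this]
  rfl

end Universal

/-! ### Reduction from the halting problem. -/

open Turing in
/-- For every partial recursive function there is a finite set of tiles for which matching unary
inputs amounts to halting. -/
theorem Partrec.exists_tiles {f : ℕ →. ℕ} (hf : Partrec f) :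
    ∃ (T : List (List ℕ × List ℕ)) (K : ℕ) (l r : List ℕ) (c : ℕ),
      (∀ t ∈ T, ∀ b ∈ t.1 ++ t.2, b < K) ∧ (∀ n, ∀ b ∈ l ++ List.replicate n c ++ r, b < K) ∧
      ∀ n, HasMatch {t | t ∈ T} (l ++ List.replicate n c ++ r) ↔ (f (2 ^ n)).Dom := by
  obtain ⟨Γ, Λ, _, _, M, S, l, c, _, hfin, hS, h⟩ := hf.exists_TM0
  have : Finite S := hfin
  obtain ⟨K, ⟨e⟩⟩ := Finite.exists_equiv_fin (ConfigLetter Γ S)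
  have he : Function.Injective fun a => (e a : ℕ) := Fin.val_injective.comp e.injective
  set F : List (ConfigLetter Γ S) × List (ConfigLetter Γ S) → List ℕ × List ℕ :=
    Prod.map (List.map fun a => (e a : ℕ)) (List.map fun a => (e a : ℕ))
  have hT : (F '' {t | RewritingTile {t | MachineRule M S t} .sep .halted t}).Finite :=
    (finite_rewritingTile finite_machineRule).image F
  refine ⟨hT.toFinset.toList, K,
    (.leftEnd :: .state ⟨default, hS.1⟩ :: l.map .tape : List (ConfigLetter Γ S)).map
      fun a => (e a : ℕ), ([.rightEnd, .sep] : List (ConfigLetter Γ S)).map fun a => (e a : ℕ),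
    e (.tape c), ?_, ?_, fun n => ?_⟩
  · intro t ht b hb
    obtain ⟨t, -, rfl⟩ : t ∈ F '' _ := (Set.Finite.mem_toFinset _).1 (Finset.mem_toList.1 ht)
    simp only [F, Prod.map_fst, Prod.map_snd, ← List.map_append, List.mem_map] at hb
    obtain ⟨a, -, rfl⟩ := hb
    exact (e a).2
  · intro n b hb
    simp only [List.mem_append, List.mem_map, List.mem_replicate] at hb
    rcases hb with (⟨a, -, rfl⟩ | ⟨-, rfl⟩) | ⟨a, -, rfl⟩ <;> exact (e _).2
  · have key := (exists_derives_halted_iff hS (l ++ List.replicate n c)).trans (h n)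
    rw [← key, ← hasMatch_rewritingTile_iff (R := {t | MachineRule M S t}) (sep := .sep)
      (fin := .halted) (by simp) (fun t ht => (MachineRule.sep_notMem ht).1)
      (fun t ht => (MachineRule.sep_notMem ht).2) (sep_notMem_configWord _ _ _),
      ← hasMatch_image_iff he]
    have hset : {t | t ∈ hT.toFinset.toList} =
        F '' {t | RewritingTile {t | MachineRule M S t} .sep .halted t} := by
      ext t
      exact Finset.mem_toList.trans (Set.Finite.mem_toFinset _)
    rw [hset]
    simp [configWord, F]

theorem findGreatest_two_pow_le (n : ℕ) :
    Nat.findGreatest (fun k => 2 ^ k ≤ 2 ^ n) (2 ^ n) = n := by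
  refine Nat.findGreatest_eq_iff.2 ⟨n.lt_two_pow_self.le, fun _ => le_rfl, fun k hk _ hle => ?_⟩
  exact absurd ((Nat.pow_le_pow_iff_right one_lt_two).1 hle) (by omega)

theorem primrec_two_pow : Primrec fun n : ℕ => 2 ^ n :=
  (Primrec.nat_rec₁ 1 (Primrec.nat_mul.comp₂ (Primrec₂.const 2) Primrec₂.right)).of_eq fun n => by
    induction n with
    | zero => rfl
    | succ n ih => rw [pow_succ', ← ih]

open Nat.Partrec in
/-- Halting of a code as a property of a power of two. -/
theorem exists_partrec_halting :
    ∃ f : ℕ →. ℕ, Partrec f ∧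
      ∀ c : Code, (f (2 ^ Encodable.encode c)).Dom ↔ (Code.eval c 0).Dom := by
  refine ⟨fun m => Code.eval (Denumerable.ofNat Code (Nat.findGreatest (fun k => 2 ^ k ≤ m) m)) 0,
    ?_, fun c => ?_⟩
  · have hlog : Primrec fun m : ℕ => Nat.findGreatest (fun k => 2 ^ k ≤ m) m :=
      Primrec.nat_findGreatest Primrec.id
        (Primrec.nat_le.comp (primrec_two_pow.comp Primrec.snd) Primrec.fst)
    exact Code.eval_part.comp ((Computable.ofNat Code).comp hlog.to_comp) (Computable.const 0)
  · simp only [findGreatest_two_pow_le, Denumerable.ofNat_encode]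

theorem computable_firstMove : Computable MatchPDA.firstMove := by
  have hpush : Primrec fun s : List ℕ => s.reverse.map MatchPDA.symbol ++ [0] :=
    Primrec.list_append.comp (Primrec.list_map Primrec.list_reverse
      (Primrec.nat_add.comp₂ Primrec₂.right (Primrec₂.const 2))) (Primrec.const [0])
  have htuple : Primrec fun s : List ℕ => ((0, some 0, 0, 1, s.reverse.map MatchPDA.symbol ++ [0]) :
      ℕ × Option ℕ × ℕ × ℕ × List ℕ) :=
    (Primrec.const 0).pair ((Primrec.const (some 0)).pair
      ((Primrec.const 0).pair ((Primrec.const 1).pair hpush)))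
  exact ((Primrec.of_equiv_symm (e := PDAMove.equivTuple)).comp htuple).to_comp

theorem PDA.computable_equivTuple_symm : Computable PDA.equivTuple.symm :=
  (Primrec.of_equiv_symm (e := PDA.equivTuple)).to_comp

theorem PDA.computable_of_moves (b : ℕ) {m : List ℕ → List PDAMove} (hm : Computable m) :
    Computable fun s => PDA.equivTuple.symm (b, b, b, 0, 0, [5], m s) :=
  PDA.computable_equivTuple_symm.comp <|
    (Computable.const b).pair <| (Computable.const b).pair <| (Computable.const b).pair <|
      (Computable.const 0).pair <| (Computable.const 0).pair <| (Computable.const [5]).pair hm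

/-- With `T` and `K` fixed, `fixedMoves` and `bound` are constants, so their noncomputable
definitions do no harm. -/
theorem computable_automaton (T : List (List ℕ × List ℕ)) (K : ℕ) :
    Computable (MatchPDA.automaton T K) :=
  PDA.computable_of_moves (MatchPDA.bound T K)
    (Computable.list_cons.comp computable_firstMove (Computable.const (MatchPDA.fixedMoves T K)))

theorem primrec_replicate {α : Type*} [Primcodable α] (a : α) :
    Primrec fun n => List.replicate n a :=
  (Primrec.list_map Primrec.list_range (Primrec₂.const a)).of_eq fun n => by
    simp [List.map_const']

/-- It is undecidable, for a deterministic linear context-free language `L` (given by a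
deterministic one-reversal pushdown automaton), whether `L` contains an element of the shuffle of
some word with itself. -/
theorem theorem4p8 :
    ¬ AlgorithmicallyDecidableOn (fun M : PDA => M.DeterministicLinear)
      (fun M : PDA => ContainsSelfShuffle M.language) := by
  classical
  rintro ⟨d, hd, hdec⟩
  obtain ⟨f, hf, hhalt⟩ := exists_partrec_halting
  obtain ⟨T, K, l, r, c, hT, hs, hmatch⟩ := hf.exists_tiles
  set g : Nat.Partrec.Code → PDA := fun p =>
    MatchPDA.automaton T K (l ++ List.replicate (Encodable.encode p) c ++ r)
  have hg : Computable g := by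
    have : Primrec fun p : Nat.Partrec.Code => l ++ List.replicate (Encodable.encode p) c ++ r :=
      Primrec.list_append.comp (Primrec.list_append.comp (Primrec.const l)
        ((primrec_replicate c).comp Primrec.encode)) (Primrec.const r)
    exact (computable_automaton T K).comp this.to_comp
  refine ComputablePred.halting_problem 0 ⟨Classical.decPred _, ?_⟩
  -- Every `g p` satisfies the promise, so the partial decider composed with `g` is total and
  -- correct.
  refine Partrec.of_eq (hd.comp hg) fun p => ?_
  obtain ⟨b, hb, hiff⟩ := hdec (g p) ⟨MatchPDA.wellFormed_automaton (hs _),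
    MatchPDA.deterministic_automaton, MatchPDA.oneReversal_automaton⟩
  change b = true ↔ ContainsSelfShuffle (MatchPDA.automaton T K
    (l ++ List.replicate (Encodable.encode p) c ++ r)).language at hiff
  rw [MatchPDA.containsSelfShuffle_automaton_iff hT (hs _), hmatch, hhalt] at hiff
  rw [Part.eq_some_iff.2 hb]
  refine congrArg Part.some ?_
  rw [Bool.eq_iff_iff, hiff, decide_eq_true_iff]
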